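/- A network is a simple graph together with an integer mark on every vertex and, for every edge, an integer mark at each of its two endpoints; all networks are connected and locally finite. Isomorphisms of networks preserve adjacency and all marks. Let $\mathcal G_*$ (resp. $\mathcal G_{**}$) be the space of isomorphism classes $[G,o]$ (resp. $[G,u,v]$) of networks with one (resp. two) distinguished vertices, with the local topology (two classes are close if the balls of a large radius $r$ around their roots are isomorphic as marked, rooted graphs) and its Borel $\sigma$-algebra. A random network $[\mathbf G,\mathbf o]$ is a random element of $\mathcal G_*$. A vertex-shift $f$ is a family of maps $f_G:V(G)\to V(G)$, indexed by the networks $G$, with $f_H\circ\sigma=\sigma\circ f_G$ for every isomorphism $\sigma:G\to H$, and such that $[G,u,v]\mapsto \mathbf 1\{f_G(u)=v\}$ is measurable on $\mathcal G_{**}$. Put $\theta_f([G,o])=[G,f_G(o)]$. A vertex $o$ of $G$ is a trap if $f_G(o)=o$. Let $d_n(o)=\#\{v\in V(G): f_G^n(v)=o\}$. Let $[\mathbf G,\mathbf o]$ be a random network with law $\mathcal P_0$, and let $f$ be a vertex-shift that is a.s. $1$-periodic on it: for $\mathcal P_0$-almost every $[G,o]$ there is $k\ge 1$ such that $f_G^{n+1}(o)=f_G^n(o)$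 for all $n\ge k$. Then almost surely the limit $[\bar{\mathbf G},\bar{\mathbf o}]=\lim_{n\to\infty}[\mathbf G,f_{\mathbf G}^n(\mathbf o)]$ exists; it is $\mathbf G$ rooted at the trap at which the orbit of $\mathbf o$ ends. The $f$-probability $\mathcal P_0^f$ of $\mathcal P_0$, i.e. the weak limit of the push-forwards $(\theta_f^n)_*\mathcal P_0$ as $n\to\infty$, exists, is unique, and is the law of $[\bar{\mathbf G},\bar{\mathbf o}]$. Suppose in addition that $[\mathbf G,\mathbf o]$ is unimodular, i.e. $\mathbb E\big[\sum_{u\in V(\mathbf G)}h([\mathbf G,\mathbf o,u])\big]=\mathbb E\big[\sum_{u\in V(\mathbf G)}h([\mathbf G,u,\mathbf o])\big]$ for every measurable $h:\mathcal G_{**}\to\mathbb R_{\ge0}$. Then $\mathcal P_0^f$ is absolutely continuous with respect to $\mathcal P_0$. The limit $d_\infty(o)=\lim_{n\to\infty}d_n(o)$ exists in $[0,\infty]$ whenever $o$ is a trap, where it equals the number $\#\{v: f_G^n(v)=o\text{ for some }n\ge0\}$ of all descendants of $o$ ($o$ included); it exists and is finite for $\mathcal P_0^f$-almost every $[G,o]$;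 and, for $\mathcal P_0$-almost every $[G,o]$, $$\frac{d\mathcal P_0^f}{d\mathcal P_0}([G,o])=d_\infty(o)\,\mathbf 1\{o\text{ is a trap}\},$$ the right-hand side being $0$ when $o$ is not a trap. -/

import Mathlib

open MeasureTheory Filter Topology
open scoped ENNReal NNReal

namespace VertexShiftNetworks

/-- A network with mark space `ℤ`: a graph with a mark on every vertex and, for every edge
`{u, v}`, one mark at each of its two endpoints. Here `emark u v h` is the mark of the pair
(edge `{u, v}`, endpoint `u`). -/
structure MarkedGraph : Type 1 where
  V : Type
  graph : SimpleGraph V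
  vmark : V → ℤ
  emark : ∀ u v : V, graph.Adj u v → ℤ

namespace MarkedGraph

/-- Isomorphisms of networks: bijections of the vertices that preserve and reflect adjacency
and preserve all marks. -/
structure Iso (G H : MarkedGraph) where
  toIso : G.graph ≃g H.graph
  vmark_eq : ∀ v, H.vmark (toIso v) = G.vmark v
  emark_eq : ∀ u v (h : G.graph.Adj u v) (h' : H.graph.Adj (toIso u) (toIso v)),
    H.emark (toIso u) (toIso v) h' = G.emark u v h

theorem emark_congr (G : MarkedGraph) {u u' v v' : G.V} (hu : u = u') (hv : v = v')
    (h : G.graph.Adj u v) (h' : G.graph.Adj u' v') : G.emark u v h = G.emark u' v' h' := by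
  subst hu hv; rfl

namespace Iso

def refl (G : MarkedGraph) : Iso G G where
  toIso := RelIso.refl _
  vmark_eq := fun _ => rfl
  emark_eq := fun _ _ _ _ => rfl

def symm {G H : MarkedGraph} (φ : Iso G H) : Iso H G where
  toIso := φ.toIso.symm
  vmark_eq := fun v => by
    rw [← φ.vmark_eq]
    exact congrArg H.vmark (φ.toIso.apply_symm_apply v)
  emark_eq := fun u v h h' => by
    rw [← φ.emark_eq _ _ h' (φ.toIso.map_adj_iff.2 h')]
    exact H.emark_congr (φ.toIso.apply_symm_apply u) (φ.toIso.apply_symm_apply v) _ _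

def trans {G H K : MarkedGraph} (φ : Iso G H) (ψ : Iso H K) : Iso G K where
  toIso := φ.toIso.trans ψ.toIso
  vmark_eq := fun v => (ψ.vmark_eq _).trans (φ.vmark_eq v)
  emark_eq := fun u v h h' =>
    (ψ.emark_eq _ _ (φ.toIso.map_adj_iff.2 h) h').trans (φ.emark_eq u v h _)

end Iso

/-- The subnetwork induced by a set of vertices, with the induced marks. -/
def induce (G : MarkedGraph) (S : Set G.V) : MarkedGraph where
  V := S
  graph := G.graph.induce S
  vmark := fun v => G.vmark v
  emark := fun u v h => G.emark u v h

end MarkedGraph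

/-- Connected, locally finite networks. Their vertex sets are countable, so that vertex sets
in `Type` represent all of them up to isomorphism. -/
structure Network : Type 1 extends MarkedGraph where
  connected : graph.Connected
  locallyFinite : ∀ v, (graph.neighborSet v).Finite

/-- A network with `k` distinguished vertices (not necessarily distinct). -/
structure RootedNetwork (k : ℕ) : Type 1 where
  net : Network
  root : Fin k → net.V

namespace RootedNetwork

variable {k : ℕ}

/-- Root-preserving isomorphism. -/
def Equivalent (A B : RootedNetwork k) : Prop :=
  ∃ φ : A.net.toMarkedGraph.Iso B.net.toMarkedGraph, ∀ i, φ.toIso (A.root i) = B.root i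

instance instSetoid (k : ℕ) : Setoid (RootedNetwork k) where
  r := Equivalent
  iseqv :=
    { refl := fun A => ⟨.refl _, fun _ => rfl⟩
      symm := fun {A B} ⟨φ, h⟩ => ⟨φ.symm, fun i => by
        rw [← h i]; exact φ.toIso.symm_apply_apply _⟩
      trans := fun {A B C} ⟨φ, h⟩ ⟨ψ, h'⟩ => ⟨φ.trans ψ, fun i => by
        rw [← h' i, ← h i]; rfl⟩ }

/-- The vertices at graph distance at most `r` from at least one of the roots. -/
def ballSet (A : RootedNetwork k) (r : ℕ) : Set A.net.V :=
  {w | ∃ i, A.net.graph.dist w (A.root i) ≤ r}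

theorem root_mem_ballSet (A : RootedNetwork k) (r : ℕ) (i : Fin k) : A.root i ∈ A.ballSet r :=
  ⟨i, by simp⟩

/-- The balls of radius `r` around the roots of `A` and of `B` are isomorphic, as networks, by
an isomorphism that maps the roots of `A` to those of `B`. -/
def BallIso (r : ℕ) (A B : RootedNetwork k) : Prop :=
  ∃ φ : (A.net.toMarkedGraph.induce (A.ballSet r)).Iso (B.net.toMarkedGraph.induce (B.ballSet r)),
    ∀ i, φ.toIso ⟨A.root i, A.root_mem_ballSet r i⟩ = ⟨B.root i, B.root_mem_ballSet r i⟩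

end RootedNetwork

/-- Equivalence classes of `k`-rooted connected locally finite networks. -/
def NetworkSpace (k : ℕ) : Type 1 := Quotient (RootedNetwork.instSetoid k)

namespace NetworkSpace

variable {k : ℕ}

/-- The class `[G, o]` (for `k = 1`), `[G, u, v]` (for `k = 2`). -/
def mk (G : Network) (o : Fin k → G.V) : NetworkSpace k := Quotient.mk _ ⟨G, o⟩

/-- The classes whose ball of radius `r` around the roots is isomorphic to that of `A`. -/
def cylinder (r : ℕ) (A : RootedNetwork k) : Set (NetworkSpace k) :=
  {x | ∃ B : RootedNetwork k, (Quotient.mk _ B : NetworkSpace k) = x ∧ RootedNetwork.BallIso r A B}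

/-- The local topology. Two integer marks at distance at most `1 / r` with `r > 1` are equal, so
this is the topology of the metric `2 ^ (-R)`, where `R` is the supremum of the radii `r` for which
the `r`-balls are isomorphic up to an error `1 / r` in the marks. -/
instance : TopologicalSpace (NetworkSpace k) :=
  TopologicalSpace.generateFrom {U | ∃ (r : ℕ) (A : RootedNetwork k), U = cylinder r A}

instance : MeasurableSpace (NetworkSpace k) := borel _

instance : BorelSpace (NetworkSpace k) := ⟨rfl⟩

end NetworkSpace

/-- The space of classes of rooted networks. -/
abbrev GStar : Type 1 := NetworkSpace 1

/-- The space of classes of doubly rooted networks. -/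
abbrev GStarStar : Type 1 := NetworkSpace 2

/-- A vertex-shift: a covariant family of maps `f_G : V(G) → V(G)` such that
`[G, u, v] ↦ 1{f_G(u) = v}` is measurable on the doubly rooted space. -/
structure VertexShift where
  toFun : ∀ G : Network, G.V → G.V
  covariant : ∀ (G H : Network) (σ : G.toMarkedGraph.Iso H.toMarkedGraph) (v : G.V),
    toFun H (σ.toIso v) = σ.toIso (toFun G v)
  measurable : MeasurableSet
    {x : GStarStar | ∃ (G : Network) (u v : G.V), x = NetworkSpace.mk G ![u, v] ∧ toFun G u = v}

namespace VertexShift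

variable (f : VertexShift)

theorem iterate_covariant {G H : Network} (σ : G.toMarkedGraph.Iso H.toMarkedGraph) (n : ℕ)
    (v : G.V) : (f.toFun H)^[n] (σ.toIso v) = σ.toIso ((f.toFun G)^[n] v) := by
  induction n generalizing v with
  | zero => rfl
  | succ n ih => rw [Function.iterate_succ_apply, Function.iterate_succ_apply, f.covariant, ih]

/-- The map `θ_f : [G, o] ↦ [G, f_G(o)]`. -/
def shift : GStar → GStar :=
  Quotient.map (fun A : RootedNetwork 1 => ⟨A.net, fun i => f.toFun A.net (A.root i)⟩) <| by
    rintro A B ⟨φ, h⟩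
    exact ⟨φ, fun i => by
      show φ.toIso (f.toFun A.net (A.root i)) = f.toFun B.net (B.root i)
      rw [← h i]; exact (f.covariant _ _ φ _).symm⟩

/-- The root `o` of `[G, o]` is a trap: `f_G(o) = o`. -/
def IsTrap : GStar → Prop :=
  Quotient.lift (fun A : RootedNetwork 1 => f.toFun A.net (A.root 0) = A.root 0) <| by
    rintro A B ⟨φ, h⟩
    simp only [eq_iff_iff]
    rw [← h 0, f.covariant, φ.toIso.injective.eq_iff]

/-- `f` is `p`-periodic at the root of `[G, o]`: there is a positive integer `k` such that
`f_G^{n+p}(o) = f_G^n(o)` for all `n ≥ k`. -/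
def IsPeriodicAt (p : ℕ) : GStar → Prop :=
  Quotient.lift (fun A : RootedNetwork 1 => ∃ k : ℕ, 0 < k ∧ ∀ n ≥ k,
    (f.toFun A.net)^[n + p] (A.root 0) = (f.toFun A.net)^[n] (A.root 0)) <| by
    rintro A B ⟨φ, h⟩
    simp only [eq_iff_iff]
    simp only [← h 0, f.iterate_covariant, φ.toIso.injective.eq_iff]

open Classical in
/-- The trap at which the `f`-orbit of the vertex `o` ends; `o` itself if there is none. -/
noncomputable def trapVertex (G : Network) (o : G.V) : G.V :=
  if h : ∃ n, f.toFun G ((f.toFun G)^[n] o) = (f.toFun G)^[n] o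
  then (f.toFun G)^[Nat.find h] o else o

open Classical in
theorem trapVertex_covariant {G H : Network} (σ : G.toMarkedGraph.Iso H.toMarkedGraph) (v : G.V) :
    f.trapVertex H (σ.toIso v) = σ.toIso (f.trapVertex G v) := by
  have key : ∀ n, (f.toFun H ((f.toFun H)^[n] (σ.toIso v)) = (f.toFun H)^[n] (σ.toIso v)) ↔
      (f.toFun G ((f.toFun G)^[n] v) = (f.toFun G)^[n] v) := fun n => by
    rw [f.iterate_covariant, f.covariant, σ.toIso.injective.eq_iff]
  unfold trapVertex
  by_cases h : ∃ n, f.toFun G ((f.toFun G)^[n] v) = (f.toFun G)^[n] v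
  · have h' : ∃ n, f.toFun H ((f.toFun H)^[n] (σ.toIso v)) = (f.toFun H)^[n] (σ.toIso v) :=
      h.imp fun n hn => (key n).2 hn
    rw [dif_pos h, dif_pos h', ← f.iterate_covariant]
    have hn : Nat.find h' = Nat.find h := Nat.find_congr' fun {n} => key n
    rw [hn]
  · have h' : ¬ ∃ n, f.toFun H ((f.toFun H)^[n] (σ.toIso v)) = (f.toFun H)^[n] (σ.toIso v) :=
      fun h' => h (h'.imp fun n hn => (key n).1 hn)
    rw [dif_neg h, dif_neg h']

/-- `[G, o]` re-rooted at the trap at which the orbit of `o` ends. -/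
noncomputable def eventualTrap : GStar → GStar :=
  Quotient.map (fun A : RootedNetwork 1 => ⟨A.net, fun i => f.trapVertex A.net (A.root i)⟩) <| by
    rintro A B ⟨φ, h⟩
    exact ⟨φ, fun i => by
      show φ.toIso (f.trapVertex A.net (A.root i)) = f.trapVertex B.net (B.root i)
      rw [← h i]; exact (f.trapVertex_covariant φ _).symm⟩

/-- `d_n(o) = #{v : f_G^n(v) = o}`, the number of descendants of order `n` of the root. -/
noncomputable def descendantCount (n : ℕ) : GStar → ℕ∞ :=
  Quotient.lift (fun A : RootedNetwork 1 => {v | (f.toFun A.net)^[n] v = A.root 0}.encard) <| by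
    rintro A B ⟨φ, h⟩
    have : {v | (f.toFun B.net)^[n] v = B.root 0} =
        φ.toIso '' {v | (f.toFun A.net)^[n] v = A.root 0} := by
      ext w
      obtain ⟨v, rfl⟩ := φ.toIso.surjective w
      rw [φ.toIso.injective.mem_set_image]
      simp only [Set.mem_ofPred_eq, f.iterate_covariant, ← h 0, φ.toIso.injective.eq_iff]
    simp only [this, φ.toIso.injective.encard_image]

/-- `#D(o)`, where `D(o) = {v : f_G^n(v) = o for some n ≥ 0}` is the set of all descendants of the
root, the root included. -/
noncomputable def totalDescendants : GStar → ℕ∞ :=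
  Quotient.lift (fun A : RootedNetwork 1 => {v | ∃ n, (f.toFun A.net)^[n] v = A.root 0}.encard) <| by
    rintro A B ⟨φ, h⟩
    have : {v | ∃ n, (f.toFun B.net)^[n] v = B.root 0} =
        φ.toIso '' {v | ∃ n, (f.toFun A.net)^[n] v = A.root 0} := by
      ext w
      obtain ⟨v, rfl⟩ := φ.toIso.surjective w
      rw [φ.toIso.injective.mem_set_image]
      simp only [Set.mem_ofPred_eq, f.iterate_covariant, ← h 0, φ.toIso.injective.eq_iff]
    simp only [this, φ.toIso.injective.encard_image]

/-- `d_∞(o) = lim_n d_n(o)`, with a junk value where the limit does not exist. -/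
noncomputable def limitDescendants (x : GStar) : ℝ≥0∞ :=
  limUnder atTop fun n => (f.descendantCount n x : ℝ≥0∞)

/-- `Q` is the `f`-probability of `P`: the push-forwards of `P` under the iterates of `θ_f` are
probability measures that converge weakly to `Q`. -/
def IsFProbability (P : Measure GStar) (Q : ProbabilityMeasure GStar) : Prop :=
  ∃ Pn : ℕ → ProbabilityMeasure GStar,
    (∀ n, AEMeasurable (f.shift^[n]) P ∧ (Pn n : Measure GStar) = P.map (f.shift^[n])) ∧
    Tendsto Pn atTop (𝓝 Q)

end VertexShift

/-- `[G, o] ↦ ∑_{u ∈ V(G)} h([G, o, u])`. -/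
noncomputable def massOut (h : GStarStar → ℝ≥0) : GStar → ℝ≥0∞ :=
  Quotient.lift (fun A : RootedNetwork 1 =>
    ∑' u : A.net.V, (h (NetworkSpace.mk A.net ![A.root 0, u]) : ℝ≥0∞)) <| by
    rintro A B ⟨φ, hφ⟩
    show (∑' u : A.net.V, (h (NetworkSpace.mk A.net ![A.root 0, u]) : ℝ≥0∞)) = _
    rw [← φ.toIso.toEquiv.tsum_eq]
    refine tsum_congr fun u => ?_
    congr 2
    exact Quotient.sound ⟨φ, fun i => by fin_cases i <;> [exact hφ 0; rfl]⟩

/-- `[G, o] ↦ ∑_{u ∈ V(G)} h([G, u, o])`. -/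
noncomputable def massIn (h : GStarStar → ℝ≥0) : GStar → ℝ≥0∞ :=
  Quotient.lift (fun A : RootedNetwork 1 =>
    ∑' u : A.net.V, (h (NetworkSpace.mk A.net ![u, A.root 0]) : ℝ≥0∞)) <| by
    rintro A B ⟨φ, hφ⟩
    show (∑' u : A.net.V, (h (NetworkSpace.mk A.net ![u, A.root 0]) : ℝ≥0∞)) = _
    rw [← φ.toIso.toEquiv.tsum_eq]
    refine tsum_congr fun u => ?_
    congr 2
    exact Quotient.sound ⟨φ, fun i => by fin_cases i <;> [rfl; exact hφ 0]⟩

/-- The mass transport principle for the law `P` of a random network. -/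
def IsUnimodular (P : Measure GStar) : Prop :=
  ∀ h : GStarStar → ℝ≥0, Measurable h → ∫⁻ x, massOut h x ∂P = ∫⁻ x, massIn h x ∂P

end VertexShiftNetworks

open VertexShiftNetworks

/-! Almost surely the orbit of the root is eventually constant at a trap. Hence the re-rooted
networks converge almost surely, and dominated convergence against bounded continuous functions
gives weak convergence to the law of the limit. No unimodularity enters here.

In the unimodular case, let each vertex `u` send mass `φ([G,u]) g([G,f(u)])` to `f(u)`. The mass
transport principle then says that `g ↦ g ∘ θ_f` is adjoint to the operator `transfer`, which sums
`φ` over the preimages of the root (`lintegral_mul_shift`). Iterating from `φ = 1` shows that `d_n`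
is the density of the law of `[G, f^n(o)]` (`lintegral_iterate_shift`). Test this identity on an
event `A` intersected with the set of traps and let `n → ∞`. One side converges by dominated
convergence, because orbits end in traps. The other converges by monotone convergence, because `d_n`
increases on traps. The density is therefore `d_∞` on the traps and `0` elsewhere; its integral is
`1`, so it is almost surely finite.

The remaining work is measurability. Cylinders are countably many and clopen, so the spaces are
second countable and regular. The map from `[G,o]` to the counting measure of the classes `[G,o,v]`
is a measurable kernel (`measurable_pairMeasure`). The shift, the operator `transfer` and the counts
`d_n` inherit measurability from it. -/

namespace VertexShiftNetworks

/-! ### Isomorphisms of induced subnetworks. -/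

namespace MarkedGraph.Iso

/-- The restriction of an isomorphism of induced subnetworks to smaller sets of vertices. -/
def restrict {G H : MarkedGraph} {S T : Set G.V} {S' T' : Set H.V}
    (φ : (G.induce S).Iso (H.induce S')) (hT : T ⊆ S) (hT' : T' ⊆ S')
    (h : ∀ w : S, (w : G.V) ∈ T ↔ (φ.toIso w : S').1 ∈ T') : (G.induce T).Iso (H.induce T') where
  toIso :=
    { toFun := fun w : T => (⟨(φ.toIso ⟨w, hT w.2⟩ : S').1, (h ⟨w, hT w.2⟩).1 w.2⟩ : T')
      invFun := fun w : T' => (⟨(φ.toIso.symm ⟨w, hT' w.2⟩ : S).1, (h _).2 (by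
        have := φ.toIso.apply_symm_apply ⟨w, hT' w.2⟩
        rw [this]; exact w.2)⟩ : T)
      left_inv := fun w => by
        have := congrArg (fun z : S => z.1) (φ.toIso.symm_apply_apply ⟨w.1, hT w.2⟩)
        exact Subtype.ext this
      right_inv := fun w => by
        have := congrArg (fun z : S' => z.1) (φ.toIso.apply_symm_apply ⟨w.1, hT' w.2⟩)
        exact Subtype.ext this
      map_rel_iff' := fun {a b} =>
        φ.toIso.map_adj_iff (v := ⟨a.1, hT a.2⟩) (w := ⟨b.1, hT b.2⟩) }
  vmark_eq := fun w => φ.vmark_eq ⟨w.1, hT w.2⟩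
  emark_eq := fun u v h h' => φ.emark_eq ⟨u.1, hT u.2⟩ ⟨v.1, hT v.2⟩ h h'

/-- The isomorphism between induced subnetworks that an isomorphism of networks gives. -/
def ofUniv {G H : MarkedGraph} (φ : G.Iso H) :
    (G.induce Set.univ).Iso (H.induce Set.univ) where
  toIso :=
    { toFun := fun w : (Set.univ : Set G.V) => (⟨φ.toIso w.1, trivial⟩ : (Set.univ : Set H.V))
      invFun := fun w : (Set.univ : Set H.V) =>
        (⟨φ.toIso.symm w.1, trivial⟩ : (Set.univ : Set G.V))
      left_inv := fun w => Subtype.ext (φ.toIso.symm_apply_apply w.1)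
      right_inv := fun w => Subtype.ext (φ.toIso.apply_symm_apply w.1)
      map_rel_iff' := fun {a b} => φ.toIso.map_adj_iff (v := a.1) (w := b.1) }
  vmark_eq := fun w => φ.vmark_eq w.1
  emark_eq := fun u v h h' => φ.emark_eq u.1 v.1 h h'

end MarkedGraph.Iso

/-! ### Isomorphic balls and their finite encodings. -/

namespace RootedNetwork

variable {k : ℕ}

/-- An isomorphism of induced subnetworks does not increase the distance to a vertex whose ball
is contained in the domain. -/
theorem dist_map_le {G H : Network} {S : Set G.V} {S' : Set H.V}
    (φ : (G.toMarkedGraph.induce S).Iso (H.toMarkedGraph.induce S')) {o : G.V} (ho : o ∈ S) {r : ℕ}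
    (hS : ∀ w, G.graph.dist w o ≤ r → w ∈ S) (w : G.V) (hw : w ∈ S) (hd : G.graph.dist w o ≤ r) :
    H.graph.dist (φ.toIso ⟨w, hw⟩ : S').1 (φ.toIso ⟨o, ho⟩ : S').1 ≤ G.graph.dist w o := by
  -- A walk of length at most `r` ending at the centre never leaves the ball, so `φ` transports it
  -- edge by edge.
  have key : ∀ (a b : G.V) (p : G.graph.Walk a b) (ha : a ∈ S) (hb : b ∈ S),
      (∀ w, G.graph.dist w b ≤ r → w ∈ S) → p.length ≤ r →
      H.graph.dist (φ.toIso ⟨a, ha⟩ : S').1 (φ.toIso ⟨b, hb⟩ : S').1 ≤ p.length := by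
    intro a b p
    induction p with
    | nil => intro ha hb _ _; simp
    | @cons u v c hadj p ih =>
      intro ha hb hS hl
      rw [SimpleGraph.Walk.length_cons] at hl ⊢
      have hv : v ∈ S := hS v ((SimpleGraph.dist_le p).trans (by omega))
      have h1 := ih hv hb hS (by omega)
      have h2 : H.graph.Adj (φ.toIso ⟨u, ha⟩ : S').1 (φ.toIso ⟨v, hv⟩ : S').1 :=
        φ.toIso.map_adj_iff.2 (show (G.graph.induce S).Adj ⟨u, ha⟩ ⟨v, hv⟩ from hadj)
      have h3 := H.connected.dist_triangle (u := (φ.toIso ⟨u, ha⟩ : S').1)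
        (v := (φ.toIso ⟨v, hv⟩ : S').1) (w := (φ.toIso ⟨c, hb⟩ : S').1)
      rw [SimpleGraph.dist_eq_one_iff_adj.2 h2] at h3
      omega
  obtain ⟨p, hp⟩ := G.connected.exists_walk_length_eq_dist w o
  exact (key w o p hw ho hS (hp ▸ hd)).trans hp.le

/-- Apply `dist_map_le` to `φ` and to its inverse. The form with a threshold `d ≤ r` is needed
because farther out the induced subnetwork no longer determines distances in the whole network. -/
theorem dist_map_eq {G H : Network} {S : Set G.V} {S' : Set H.V}
    (φ : (G.toMarkedGraph.induce S).Iso (H.toMarkedGraph.induce S')) {o : G.V} {o' : H.V}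
    (ho : o ∈ S) (ho' : o' ∈ S') (hoo : φ.toIso ⟨o, ho⟩ = ⟨o', ho'⟩) {r : ℕ}
    (hS : ∀ w, G.graph.dist w o ≤ r → w ∈ S) (hS' : ∀ w, H.graph.dist w o' ≤ r → w ∈ S')
    {d : ℕ} (hd : d ≤ r) (w : S) :
    G.graph.dist w.1 o ≤ d ↔ H.graph.dist (φ.toIso w : S').1 o' ≤ d := by
  constructor
  · intro h
    have := dist_map_le φ ho hS w.1 w.2 (h.trans hd)
    rw [hoo] at this
    exact this.trans h
  · intro h
    have := dist_map_le φ.symm ho' hS' (φ.toIso w : S').1 (φ.toIso w : S').2 (h.trans hd)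
    have e1 : φ.symm.toIso ⟨o', ho'⟩ = ⟨o, ho⟩ := by
      rw [← hoo]; exact φ.toIso.symm_apply_apply _
    have e2 : φ.symm.toIso (φ.toIso w) = w := φ.toIso.symm_apply_apply _
    rw [e1] at this
    erw [e2] at this
    exact this.trans h

/-- An isomorphism between induced subnetworks that contain the `r`-balls restricts to the
`r`-balls. -/
theorem ballIso_of_iso {A B : RootedNetwork k} {r : ℕ} {S : Set A.net.V} {S' : Set B.net.V}
    (hS : A.ballSet r ⊆ S) (hS' : B.ballSet r ⊆ S')
    (φ : (A.net.toMarkedGraph.induce S).Iso (B.net.toMarkedGraph.induce S'))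
    (hφ : ∀ i, φ.toIso ⟨A.root i, hS (A.root_mem_ballSet r i)⟩ =
      ⟨B.root i, hS' (B.root_mem_ballSet r i)⟩) : BallIso r A B := by
  refine ⟨φ.restrict hS hS' fun w => ?_, fun i => ?_⟩
  · refine exists_congr fun i => dist_map_eq φ _ _ (hφ i) (fun w hw => hS ⟨i, hw⟩)
      (fun w hw => hS' ⟨i, hw⟩) le_rfl w
  · have := congrArg (fun z : S' => z.1) (hφ i)
    exact Subtype.ext this

theorem BallIso.refl (r : ℕ) (A : RootedNetwork k) : BallIso r A A :=
  ⟨.refl _, fun _ => rfl⟩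

theorem BallIso.symm {r : ℕ} {A B : RootedNetwork k} : BallIso r A B → BallIso r B A := by
  rintro ⟨φ, h⟩
  exact ⟨φ.symm, fun i => by rw [← h i]; exact φ.toIso.symm_apply_apply _⟩

theorem BallIso.trans {r : ℕ} {A B C : RootedNetwork k} :
    BallIso r A B → BallIso r B C → BallIso r A C := by
  rintro ⟨φ, h⟩ ⟨ψ, h'⟩
  exact ⟨φ.trans ψ, fun i => by rw [← h' i, ← h i]; rfl⟩

theorem Equivalent.ballIso {A B : RootedNetwork k} (h : A.Equivalent B) (r : ℕ) :
    BallIso r A B := by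
  obtain ⟨φ, h⟩ := h
  exact ballIso_of_iso (Set.subset_univ _) (Set.subset_univ _) φ.ofUniv
    fun i => Subtype.ext (h i)

theorem BallIso.mono {r s : ℕ} (hrs : r ≤ s) {A B : RootedNetwork k} (h : BallIso s A B) :
    BallIso r A B := by
  obtain ⟨φ, h⟩ := h
  exact ballIso_of_iso (S := A.ballSet s) (S' := B.ballSet s) (fun w ⟨i, hi⟩ => ⟨i, hi.trans hrs⟩)
    (fun w ⟨i, hi⟩ => ⟨i, hi.trans hrs⟩) φ h

/-- Change of the roots along a map of the indices. -/
def reindex {l : ℕ} (e : Fin l → Fin k) (A : RootedNetwork k) : RootedNetwork l :=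
  ⟨A.net, fun i => A.root (e i)⟩

theorem BallIso.reindex {l : ℕ} (e : Fin l → Fin k) {r : ℕ} {A B : RootedNetwork k}
    (h : BallIso r A B) : BallIso r (A.reindex e) (B.reindex e) := by
  obtain ⟨φ, h⟩ := h
  exact ballIso_of_iso (A := A.reindex e) (B := B.reindex e)
    (S := A.ballSet r) (S' := B.ballSet r) (fun w ⟨i, hi⟩ => ⟨e i, hi⟩)
    (fun w ⟨i, hi⟩ => ⟨e i, hi⟩) φ fun i => h (e i)

theorem finite_dist_le (G : Network) (o : G.V) (r : ℕ) : {w | G.graph.dist w o ≤ r}.Finite := by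
  induction r with
  | zero =>
    refine (Set.finite_singleton o).subset fun w hw => ?_
    exact G.connected.dist_eq_zero_iff.1 (Nat.le_zero.1 hw)
  | succ r ih =>
    refine ((ih.biUnion fun w _ => G.locallyFinite w).union (Set.finite_singleton o)).subset
      fun w hw => ?_
    obtain ⟨p, hp⟩ := G.connected.exists_walk_length_eq_dist w o
    cases p with
    | nil => exact Or.inr rfl
    | @cons _ v _ hadj p =>
      refine Or.inl (Set.mem_biUnion (x := v) ?_ hadj.symm)
      have := SimpleGraph.dist_le p
      have hw' : G.graph.dist w o ≤ r + 1 := hw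
      rw [SimpleGraph.Walk.length_cons] at hp
      show G.graph.dist v o ≤ r
      omega

theorem finite_ballSet (A : RootedNetwork k) (r : ℕ) : (A.ballSet r).Finite := by
  have : A.ballSet r = ⋃ i, {w | A.net.graph.dist w (A.root i) ≤ r} := by
    ext w; simp [ballSet]
  rw [this]
  exact Set.finite_iUnion fun i => finite_dist_le _ _ _

/-- A finite rooted network on `Fin n`, as raw data. -/
abbrev Code (k : ℕ) : Type :=
  Σ n : ℕ, (Fin n → Fin n → Prop) × (Fin n → ℤ) × (Fin n → Fin n → ℤ) × (Fin k → Fin n)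

open Classical in
/-- The raw data of the `r`-ball of a rooted network, in some enumeration of its vertices. -/
noncomputable def code (r : ℕ) (A : RootedNetwork k) : Code k :=
  haveI : Fintype (A.ballSet r) := (A.finite_ballSet r).fintype
  let e := (Fintype.equivFin (A.ballSet r)).symm
  ⟨Fintype.card (A.ballSet r), fun i j => A.net.graph.Adj (e i) (e j), fun i => A.net.vmark (e i),
    fun i j => if h : A.net.graph.Adj (e i) (e j) then A.net.emark _ _ h else 0,
    fun i => e.symm ⟨A.root i, A.root_mem_ballSet r i⟩⟩

theorem ballIso_of_code_eq {r : ℕ} {A B : RootedNetwork k} (h : code r A = code r B) :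
    BallIso r A B := by
  classical
  let _ : Fintype (A.ballSet r) := (A.finite_ballSet r).fintype
  let _ : Fintype (B.ballSet r) := (B.finite_ballSet r).fintype
  -- The sizes and enumerations are made arbitrary so that `n = m` can be substituted; the
  -- isomorphism is then `e' ∘ e⁻¹`.
  have key : ∀ (n m : ℕ) (e : Fin n ≃ A.ballSet r) (e' : Fin m ≃ B.ballSet r),
      (⟨n, fun i j => A.net.graph.Adj (e i) (e j), fun i => A.net.vmark (e i),
        fun i j => if h : A.net.graph.Adj (e i) (e j) then A.net.emark _ _ h else 0,
        fun i => e.symm ⟨A.root i, A.root_mem_ballSet r i⟩⟩ : Code k) =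
      ⟨m, fun i j => B.net.graph.Adj (e' i) (e' j), fun i => B.net.vmark (e' i),
        fun i j => if h : B.net.graph.Adj (e' i) (e' j) then B.net.emark _ _ h else 0,
        fun i => e'.symm ⟨B.root i, B.root_mem_ballSet r i⟩⟩ → BallIso r A B := by
    intro n m e e' heq
    obtain rfl : n = m := congrArg Sigma.fst heq
    have heq := eq_of_heq (Sigma.mk.inj heq).2
    simp only [Prod.mk.injEq] at heq
    obtain ⟨h1, h2, h3, h4⟩ := heq
    have h1' : ∀ a b : A.ballSet r, A.net.graph.Adj a b ↔
        B.net.graph.Adj (e' (e.symm a)) (e' (e.symm b)) := fun a b => by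
      have := congrFun (congrFun h1 (e.symm a)) (e.symm b)
      simpa only [Equiv.apply_symm_apply] using Iff.of_eq this
    have h2' : ∀ a : A.ballSet r, A.net.vmark a = B.net.vmark (e' (e.symm a)) := fun a => by
      simpa only [Equiv.apply_symm_apply] using congrFun h2 (e.symm a)
    have h3' : ∀ (a b : A.ballSet r) (h : A.net.graph.Adj a b)
        (h' : B.net.graph.Adj (e' (e.symm a)) (e' (e.symm b))),
        A.net.emark a b h = B.net.emark _ _ h' := fun a b hab hab' => by
      have := congrFun (congrFun h3 (e.symm a)) (e.symm b)
      simp only [Equiv.apply_symm_apply] at this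
      rwa [dif_pos hab, dif_pos hab'] at this
    refine ⟨⟨⟨e.symm.trans e', fun {a b} => (h1' a b).symm⟩, fun a => (h2' a).symm,
      fun a b hab hab' => (h3' a b hab hab').symm⟩, fun i => ?_⟩
    · have := congrFun h4 i
      show e' (e.symm _) = _
      rw [this, Equiv.apply_symm_apply]
  exact key _ _ _ _ h

end RootedNetwork

/-! ### The local topology and its Borel sets. -/

namespace NetworkSpace

open RootedNetwork

variable {k : ℕ}

/-- The class of a rooted network. -/
def ofRooted (A : RootedNetwork k) : NetworkSpace k := Quotient.mk _ A

theorem ind {p : NetworkSpace k → Prop} (h : ∀ A, p (ofRooted A)) (x : NetworkSpace k) : p x :=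
  Quotient.ind h x

theorem ofRooted_mem_cylinder {r : ℕ} {A B : RootedNetwork k} :
    ofRooted B ∈ cylinder r A ↔ BallIso r A B := by
  constructor
  · rintro ⟨C, hC, h⟩
    exact h.trans (Equivalent.ballIso (Quotient.exact hC) r)
  · exact fun h => ⟨B, rfl, h⟩

theorem isOpen_cylinder (r : ℕ) (A : RootedNetwork k) : IsOpen (cylinder r A) :=
  .basic _ ⟨r, A, rfl⟩

/-- A set is open if membership is determined by the `r`-ball around the roots. -/
theorem isOpen_of_ballIso {U : Set (NetworkSpace k)} (r : ℕ)
    (hU : ∀ A B : RootedNetwork k, BallIso r A B → ofRooted A ∈ U →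
      ofRooted B ∈ U) : IsOpen U := by
  refine isOpen_iff_forall_mem_open.2 fun x hx => ?_
  induction x using NetworkSpace.ind with | _ A => ?_
  refine ⟨cylinder r A, ?_, isOpen_cylinder r A, ofRooted_mem_cylinder.2 (.refl r A)⟩
  rintro _ ⟨B, rfl, h⟩
  exact hU A B h hx

theorem isClopen_cylinder (r : ℕ) (A : RootedNetwork k) : IsClopen (cylinder r A) := by
  refine ⟨⟨isOpen_of_ballIso r fun B C h hB hC => hB ?_⟩, isOpen_cylinder r A⟩
  rw [ofRooted_mem_cylinder] at hC ⊢
  exact hC.trans h.symm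

theorem measurable_of_ballIso {β : Type*} [MeasurableSpace β] {g : NetworkSpace k → β} (r : ℕ)
    (hg : ∀ A B : RootedNetwork k, BallIso r A B →
      g (ofRooted A) = g (ofRooted B)) : Measurable g := fun s _ =>
  (isOpen_of_ballIso r fun A B h hA => show g _ ∈ s from hg A B h ▸ hA).measurableSet

theorem cylinder_eq_of_ballIso {r : ℕ} {A B : RootedNetwork k} (h : BallIso r A B) :
    cylinder r A = cylinder r B := by
  ext x
  induction x using NetworkSpace.ind with | _ C => ?_
  rw [ofRooted_mem_cylinder, ofRooted_mem_cylinder]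
  exact ⟨h.symm.trans, h.trans⟩

variable (k) in
-- For fixed `r` a cylinder depends only on the code of its centre, and codes form a countable type.
-- Codes depend on a chosen enumeration, but equal codes implying isomorphic balls is all that is
-- used.
theorem countable_cylinders :
    {U : Set (NetworkSpace k) | ∃ (r : ℕ) (A : RootedNetwork k), U = cylinder r A}.Countable := by
  have : {U : Set (NetworkSpace k) | ∃ (r : ℕ) (A : RootedNetwork k), U = cylinder r A} =
      ⋃ r : ℕ, Set.range fun A : RootedNetwork k => cylinder r A := by
    ext U; simp [eq_comm]
  rw [this]
  refine Set.countable_iUnion fun r => ?_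
  have hf : (fun A : RootedNetwork k => cylinder r A).FactorsThrough (code r) :=
    fun A B h => cylinder_eq_of_ballIso (ballIso_of_code_eq h)
  refine (Set.countable_range
    (Function.extend (code r) (fun A : RootedNetwork k => cylinder r A) fun _ => ∅)).mono ?_
  rintro _ ⟨A, rfl⟩
  exact ⟨code r A, hf.extend_apply _ A⟩

instance : SecondCountableTopology (NetworkSpace k) :=
  ⟨⟨_, countable_cylinders k, rfl⟩⟩

/-- The subbasis is clopen. Together with second countability this gives pseudo-metrizability, which
is what almost sure limits and uniqueness of weak limits rely on. -/
instance : RegularSpace (NetworkSpace k) := by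
  refine (regularSpace_generateFrom rfl).2 ?_
  rintro _ ⟨r, A, rfl⟩ x hx
  exact Filter.disjoint_iff.2 ⟨_, (isClopen_cylinder r A).compl.isOpen.mem_nhdsSet.2 subset_rfl,
    _, (isOpen_cylinder r A).mem_nhds hx, disjoint_compl_left⟩

theorem measurableSpace_eq_generateFrom :
    (inferInstance : MeasurableSpace (NetworkSpace k)) = MeasurableSpace.generateFrom
      {U | ∃ (r : ℕ) (A : RootedNetwork k), U = cylinder r A} :=
  borel_eq_generateFrom_of_subbasis rfl

/-- As for balls in an ultrametric space, any member of a cylinder can serve as its centre, so two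
cylinders that meet are nested. -/
theorem isPiSystem_cylinders : IsPiSystem
    {U : Set (NetworkSpace k) | ∃ (r : ℕ) (A : RootedNetwork k), U = cylinder r A} := by
  rintro _ ⟨r, A, rfl⟩ _ ⟨s, B, rfl⟩ ⟨x, hx, hx'⟩
  induction x using NetworkSpace.ind with | _ C => ?_
  refine ⟨max r s, C, ?_⟩
  rw [ofRooted_mem_cylinder] at hx hx'
  rw [cylinder_eq_of_ballIso hx, cylinder_eq_of_ballIso hx']
  ext y
  induction y using NetworkSpace.ind with | _ D => ?_
  rw [Set.mem_inter_iff, ofRooted_mem_cylinder, ofRooted_mem_cylinder, ofRooted_mem_cylinder]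
  refine ⟨fun ⟨h1, h2⟩ => ?_, fun h => ⟨h.mono (le_max_left _ _), h.mono (le_max_right _ _)⟩⟩
  rcases max_cases r s with ⟨h, _⟩ | ⟨h, _⟩ <;> rw [h] <;> assumption

/-- Change of the roots along a map of the indices. -/
def reindex {l : ℕ} (e : Fin l → Fin k) : NetworkSpace k → NetworkSpace l :=
  Quotient.map (RootedNetwork.reindex e) fun _ _ ⟨φ, h⟩ => ⟨φ, fun i => h (e i)⟩

theorem continuous_reindex {l : ℕ} (e : Fin l → Fin k) : Continuous (reindex e) := by
  refine continuous_generateFrom_iff.2 ?_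
  rintro _ ⟨r, C, rfl⟩
  refine isOpen_of_ballIso r fun A B h hA => ?_
  exact ofRooted_mem_cylinder.2 ((ofRooted_mem_cylinder.1 hA).trans (h.reindex e))

theorem measurable_reindex {l : ℕ} (e : Fin l → Fin k) : Measurable (reindex e) :=
  (continuous_reindex e).measurable

end NetworkSpace

end VertexShiftNetworks

namespace VertexShiftNetworks

/-! ### The kernel from singly to doubly rooted networks. -/

namespace NetworkSpace

open RootedNetwork

theorem gStar_ind {p : GStar → Prop} (h : ∀ (G : Network) (o : G.V), p (mk G fun _ => o))
    (x : GStar) : p x := by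
  induction x using NetworkSpace.ind with | _ A => ?_
  have : A = ⟨A.net, fun _ => A.root 0⟩ := by
    obtain ⟨G, o⟩ := A
    congr 1
    funext i
    rw [Subsingleton.elim i 0]
  rw [this]
  exact h _ _

/-- The class `[G, u]` of `[G, u, v]`. -/
def fstRoot : GStarStar → GStar := reindex fun _ => 0

/-- The class `[G, v]` of `[G, u, v]`. -/
def sndRoot : GStarStar → GStar := reindex fun _ => 1

/-- The class `[G, v, u]` of `[G, u, v]`. -/
def swapRoot : GStarStar → GStarStar := reindex ![1, 0]

theorem measurable_fstRoot : Measurable fstRoot := measurable_reindex _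
theorem measurable_sndRoot : Measurable sndRoot := measurable_reindex _
theorem measurable_swapRoot : Measurable swapRoot := measurable_reindex _

theorem fstRoot_mk (G : Network) (u v : G.V) : fstRoot (mk G ![u, v]) = mk G fun _ => u := rfl

theorem sndRoot_mk (G : Network) (u v : G.V) : sndRoot (mk G ![u, v]) = mk G fun _ => v := rfl

theorem swapRoot_mk (G : Network) (u v : G.V) : swapRoot (mk G ![u, v]) = mk G ![v, u] := by
  show mk G (fun i => (![u, v] : Fin 2 → G.V) ((![1, 0] : Fin 2 → Fin 2) i)) = _
  congr 1
  funext i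
  fin_cases i <;> rfl

/-- The distance between the two roots. -/
noncomputable def rootDist : GStarStar → ℕ :=
  Quotient.lift (fun A : RootedNetwork 2 => A.net.graph.dist (A.root 1) (A.root 0)) <| by
    rintro A B ⟨φ, h⟩
    have h1 := fun {d} => dist_map_eq (d := d) φ.ofUniv (o := A.root 0) (o' := B.root 0) trivial trivial
      (Subtype.ext (h 0)) (r := max (A.net.graph.dist (A.root 1) (A.root 0))
        (B.net.graph.dist (B.root 1) (B.root 0))) (fun _ _ => trivial) (fun _ _ => trivial)
    have h2 : (φ.ofUniv.toIso ⟨A.root 1, trivial⟩ : (Set.univ : Set B.net.V)).1 = B.root 1 := h 1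
    apply le_antisymm
    · have := (h1 (le_max_right _ _) ⟨A.root 1, trivial⟩).2
      rw [h2] at this
      exact this le_rfl
    · have := (h1 (le_max_left _ _) ⟨A.root 1, trivial⟩).1
      rw [h2] at this
      exact this le_rfl

theorem measurable_rootDist : Measurable rootDist := by
  refine measurable_of_Iic fun d => (isOpen_of_ballIso d fun A B hAB hA => ?_).measurableSet
  obtain ⟨φ, h⟩ := hAB
  have := (dist_map_eq φ _ _ (h 0) (fun w hw => ⟨0, hw⟩) (fun w hw => ⟨0, hw⟩) le_rfl
    ⟨A.root 1, A.root_mem_ballSet d 1⟩).1 hA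
  rw [h 1] at this
  exact this

/-- For `v` at distance `d` from the root, the `s`-balls around both lie in the `(d + s)`-ball of
the root. That larger ball therefore decides membership in `U`, and the isomorphism injects one set
of vertices into the other. -/
theorem encard_le_of_ballIso {d s : ℕ} {A B : RootedNetwork 1} (h : BallIso (d + s) A B)
    {U : Set GStarStar} (hU : ∀ C D : RootedNetwork 2, BallIso s C D → ofRooted C ∈ U →
      ofRooted D ∈ U) :
    {v | mk A.net ![A.root 0, v] ∈ U ∩ rootDist ⁻¹' {d}}.encard ≤
      {v | mk B.net ![B.root 0, v] ∈ U ∩ rootDist ⁻¹' {d}}.encard := by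
  obtain ⟨φ, h⟩ := h
  have hA : ∀ v, A.net.graph.dist v (A.root 0) ≤ d → v ∈ A.ballSet (d + s) :=
    fun v hv => ⟨0, hv.trans (Nat.le_add_right d s)⟩
  have hd : ∀ {e}, e ≤ d + s → ∀ w : A.ballSet (d + s), _ ↔ _ := fun {e} he w =>
    dist_map_eq φ (A.root_mem_ballSet _ 0) (B.root_mem_ballSet _ 0) (h 0)
      (fun w hw => ⟨0, hw⟩) (fun w hw => ⟨0, hw⟩) he w
  have hsub : ∀ (D : RootedNetwork 1) (v : D.net.V), D.net.graph.dist v (D.root 0) ≤ d →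
      ballSet (⟨D.net, ![D.root 0, v]⟩ : RootedNetwork 2) s ⊆ D.ballSet (d + s) := by
    rintro D v hv w ⟨i, hi⟩
    fin_cases i
    · exact ⟨0, le_trans hi (Nat.le_add_left s d)⟩
    · refine ⟨0, ?_⟩
      have h1 := D.net.connected.dist_triangle (u := w) (v := v) (w := D.root 0)
      have h2 : D.net.graph.dist w v ≤ s := hi
      omega
  have key : ∀ v (hv : A.net.graph.dist v (A.root 0) = d),
      mk A.net ![A.root 0, v] ∈ U →
      mk B.net ![B.root 0, (φ.toIso ⟨v, hA v hv.le⟩ : B.ballSet (d + s)).1] ∈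
        U ∩ rootDist ⁻¹' {d} := by
    intro v hv hC
    have h1 := (hd (Nat.le_add_right d s) ⟨v, hA v hv.le⟩).1 hv.le
    refine ⟨?_, ?_⟩
    · refine hU _ _ ?_ hC
      refine ballIso_of_iso (hsub A v hv.le) (hsub B _ h1) φ fun i => ?_
      fin_cases i
      · exact h 0
      · rfl
    · show B.net.graph.dist _ _ = d
      refine le_antisymm h1 (not_lt.1 fun hlt => ?_)
      -- A distance below `d` in `B` would pull back to a distance at most `d - 1` in `A`.
      have h2 := (hd (e := d - 1) (by omega) ⟨v, hA v hv.le⟩).2 (Nat.le_sub_one_of_lt hlt)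
      have h3 : A.net.graph.dist v (A.root 0) ≤ d - 1 := h2
      omega
  refine Function.Embedding.encard_le ⟨fun v => ⟨_, key v.1 v.2.2 v.2.1⟩, fun v w hvw => ?_⟩
  have h1 := φ.toIso.injective (Subtype.ext (congrArg (fun z => z.1) hvw))
  exact Subtype.ext (congrArg (fun z : A.ballSet (d + s) => z.1) h1)

/-- The measure `∑_v δ_{[G, o, v]}`. -/
noncomputable def pairMeasure : GStar → Measure GStarStar :=
  Quotient.lift (fun A : RootedNetwork 1 =>
    @Measure.map _ _ ⊤ _ (fun v => mk A.net ![A.root 0, v]) (@Measure.count _ ⊤)) <| by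
    rintro A B ⟨φ, h⟩
    ext E hE
    rw [@Measure.map_apply _ _ ⊤ _ _ _ measurable_from_top _ hE,
      @Measure.map_apply _ _ ⊤ _ _ _ measurable_from_top _ hE,
      @Measure.count_apply _ ⊤ _ trivial, @Measure.count_apply _ ⊤ _ trivial]
    have : (fun v => mk B.net ![B.root 0, v]) ⁻¹' E =
        φ.toIso '' ((fun v => mk A.net ![A.root 0, v]) ⁻¹' E) := by
      ext w
      obtain ⟨v, rfl⟩ := φ.toIso.surjective w
      rw [φ.toIso.injective.mem_set_image]
      have e : mk A.net ![A.root 0, v] = mk B.net ![B.root 0, φ.toIso v] :=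
        Quotient.sound ⟨φ, fun i => by fin_cases i <;> [exact h 0; rfl]⟩
      simp only [Set.mem_preimage, e]
    rw [this, φ.toIso.injective.encard_image]

theorem pairMeasure_apply (G : Network) (o : G.V) {E : Set GStarStar} (hE : MeasurableSet E) :
    pairMeasure (mk G fun _ => o) E = ({v | mk G ![o, v] ∈ E}.encard : ℝ≥0∞) := by
  show @Measure.map _ _ ⊤ _ (fun v => mk G ![o, v]) (@Measure.count _ ⊤) E = _
  rw [@Measure.map_apply _ _ ⊤ _ _ _ measurable_from_top _ hE, @Measure.count_apply _ ⊤ _ trivial]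
  rfl

theorem lintegral_pairMeasure (G : Network) (o : G.V) {h : GStarStar → ℝ≥0∞}
    (hh : Measurable h) :
    ∫⁻ y, h y ∂pairMeasure (mk G fun _ => o) = ∑' v, h (mk G ![o, v]) := by
  let _ : MeasurableSpace G.V := ⊤
  show ∫⁻ y, h y ∂(Measure.count.map fun v => mk G ![o, v]) = _
  rw [lintegral_map hh measurable_from_top, lintegral_count]

/-- The kernel may have infinite mass, so it is cut according to the distance `d` between the roots.
By local finiteness each piece is finite, which permits a π-λ argument; on cylinders its mass
depends only on a ball, and the pieces are summed at the end. -/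
theorem measurable_pairMeasure : Measurable pairMeasure := by
  have hD : ∀ d, MeasurableSet (rootDist ⁻¹' {d}) := fun d => measurable_rootDist trivial
  have hfin : ∀ d x, pairMeasure x (rootDist ⁻¹' {d}) < ∞ := fun d x => by
    induction x using gStar_ind with | _ G o => ?_
    rw [pairMeasure_apply _ _ (hD d)]
    have : {v | mk G ![o, v] ∈ rootDist ⁻¹' {d}}.Finite :=
      (finite_dist_le G o d).subset fun v hv => le_of_eq hv
    simpa using this
  have hr : ∀ d, Measurable fun x => (pairMeasure x).restrict (rootDist ⁻¹' {d}) := by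
    intro d
    have : ∀ x, IsFiniteMeasure ((pairMeasure x).restrict (rootDist ⁻¹' {d})) :=
      fun x => ⟨by rw [Measure.restrict_apply_univ]; exact hfin d x⟩
    have hc : ∀ (s : ℕ) (U : Set GStarStar), MeasurableSet U → (∀ C D : RootedNetwork 2,
        BallIso s C D → ofRooted C ∈ U → ofRooted D ∈ U) → Measurable fun x =>
        (pairMeasure x).restrict (rootDist ⁻¹' {d}) U := fun s U hUm hU => by
      refine measurable_of_ballIso (d + s) fun A B h => ?_
      simp only [Measure.restrict_apply hUm]
      have e : ∀ A : RootedNetwork 1, pairMeasure (ofRooted A) (U ∩ rootDist ⁻¹' {d}) =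
          ({v | mk A.net ![A.root 0, v] ∈ U ∩ rootDist ⁻¹' {d}}.encard : ℝ≥0∞) := by
        intro A
        rw [← pairMeasure_apply _ _ (hUm.inter (hD d))]
        rfl
      rw [e, e, le_antisymm (encard_le_of_ballIso h hU) (encard_le_of_ballIso h.symm hU)]
    refine Measurable.measure_of_isPiSystem measurableSpace_eq_generateFrom isPiSystem_cylinders
      ?_ (hc 0 _ .univ fun _ _ _ _ => trivial)
    rintro _ ⟨s, C, rfl⟩
    refine hc s _ (isOpen_cylinder s C).measurableSet fun A B h hA => ?_
    exact ofRooted_mem_cylinder.2 ((ofRooted_mem_cylinder.1 hA).trans h)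
  refine Measure.measurable_of_measurable_coe _ fun E hE => ?_
  have : ∀ x, pairMeasure x E = ∑' d, (pairMeasure x).restrict (rootDist ⁻¹' {d}) E := fun x => by
    simp only [Measure.restrict_apply hE]
    rw [← measure_iUnion _ fun d => hE.inter (hD d)]
    · congr 1
      ext y; simp
    · intro d e hde
      refine Set.disjoint_left.2 fun y hy hy' => hde ?_
      exact hy.2.symm.trans hy'.2
  simp only [this]
  exact Measurable.tsum fun d => (Measure.measurable_coe hE).comp (hr d)

end NetworkSpace

end VertexShiftNetworks

namespace VertexShiftNetworks

open NetworkSpace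

/-! ### Measurability of the shift and the transfer operator. -/

namespace VertexShift

variable (f : VertexShift)

/-- The set of the classes `[G, u, v]` with `f_G(u) = v`. -/
def graphSet : Set GStarStar :=
  {x | ∃ (G : Network) (u v : G.V), x = NetworkSpace.mk G ![u, v] ∧ f.toFun G u = v}

theorem measurableSet_graphSet : MeasurableSet f.graphSet := f.measurable

theorem mk_mem_graphSet {G : Network} {u v : G.V} :
    NetworkSpace.mk G ![u, v] ∈ f.graphSet ↔ f.toFun G u = v := by
  refine ⟨?_, fun h => ⟨G, u, v, rfl, h⟩⟩
  rintro ⟨H, u', v', h, h'⟩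
  obtain ⟨φ, hφ⟩ := Quotient.exact h
  have h0 : φ.toIso u = u' := hφ 0
  have h1 : φ.toIso v = v' := hφ 1
  apply φ.toIso.injective
  rw [← f.covariant, h0, h', h1]

theorem shift_mk (G : Network) (o : G.V) :
    f.shift (NetworkSpace.mk G fun _ => o) = NetworkSpace.mk G fun _ => f.toFun G o := rfl

theorem iterate_shift_mk (G : Network) (o : G.V) (n : ℕ) :
    f.shift^[n] (NetworkSpace.mk G fun _ => o) = NetworkSpace.mk G fun _ => (f.toFun G)^[n] o := by
  induction n generalizing o with
  | zero => rfl
  | succ n ih => rw [Function.iterate_succ_apply, shift_mk, ih, Function.iterate_succ_apply]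

theorem isTrap_mk {G : Network} {o : G.V} :
    f.IsTrap (NetworkSpace.mk G fun _ => o) ↔ f.toFun G o = o := Iff.rfl

theorem descendantCount_mk (n : ℕ) (G : Network) (o : G.V) :
    f.descendantCount n (NetworkSpace.mk G fun _ => o) = {v | (f.toFun G)^[n] v = o}.encard := rfl

theorem measurable_shift : Measurable f.shift := by
  intro A hA
  have hE : MeasurableSet (f.graphSet ∩ sndRoot ⁻¹' A) :=
    f.measurableSet_graphSet.inter (measurable_sndRoot hA)
  -- The image of the root is the only second root allowed by `graphSet`, so the kernel charges this
  -- set exactly when that image lies in `A`.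
  have : f.shift ⁻¹' A = {x | pairMeasure x (f.graphSet ∩ sndRoot ⁻¹' A) ≠ 0} := by
    ext x
    induction x using gStar_ind with | _ G o => ?_
    rw [Set.mem_ofPred_eq, pairMeasure_apply _ _ hE, Set.mem_preimage, shift_mk]
    simp only [ne_eq, ENat.toENNReal_eq_zero, Set.encard_eq_zero, ← Set.nonempty_iff_ne_empty]
    constructor
    · exact fun h => ⟨f.toFun G o, f.mk_mem_graphSet.2 rfl, h⟩
    · rintro ⟨v, hv, hv'⟩
      rw [f.mk_mem_graphSet.1 hv]
      exact hv'
  rw [this]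
  exact ((Measure.measurable_coe hE).comp measurable_pairMeasure) (measurableSet_singleton 0).compl

theorem measurableSet_isTrap : MeasurableSet {x | f.IsTrap x} := by
  have : {x | f.IsTrap x} = (reindex fun _ => 0 : GStar → GStarStar) ⁻¹' f.graphSet := by
    ext x
    induction x using gStar_ind with | _ G o => ?_
    have e : (reindex fun _ => 0 : GStar → GStarStar) (NetworkSpace.mk G fun _ => o) = NetworkSpace.mk G ![o, o] := by
      show NetworkSpace.mk G (fun _ => o) = _
      congr 1
      funext i
      fin_cases i <;> rfl
    rw [Set.mem_preimage, e, mk_mem_graphSet]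
    exact f.isTrap_mk
  rw [this]
  exact measurable_reindex _ f.measurableSet_graphSet

/-- The transfer operator `φ ↦ ([G, o] ↦ ∑_{f_G(u) = o} φ([G, u]))`. -/
noncomputable def transfer (φ : GStar → ℝ≥0∞) (x : GStar) : ℝ≥0∞ :=
  ∫⁻ y, f.graphSet.indicator 1 (swapRoot y) * φ (sndRoot y) ∂pairMeasure x

theorem measurable_transfer {φ : GStar → ℝ≥0∞} (hφ : Measurable φ) :
    Measurable (f.transfer φ) :=
  (Measure.measurable_lintegral (((measurable_one.indicator f.measurableSet_graphSet).comp
    measurable_swapRoot).mul (hφ.comp measurable_sndRoot))).comp measurable_pairMeasure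

open Classical in
theorem transfer_mk {φ : GStar → ℝ≥0∞} (hφ : Measurable φ) (G : Network) (o : G.V) :
    f.transfer φ (NetworkSpace.mk G fun _ => o) =
      ∑' u, (if f.toFun G u = o then 1 else 0) * φ (NetworkSpace.mk G fun _ => u) := by
  unfold transfer
  refine (lintegral_pairMeasure _ _ (((measurable_one.indicator f.measurableSet_graphSet).comp
    measurable_swapRoot).mul (hφ.comp measurable_sndRoot))).trans (tsum_congr fun u => ?_)
  dsimp only [Pi.mul_apply, Function.comp_apply]
  rw [swapRoot_mk, sndRoot_mk, Set.indicator_apply, f.mk_mem_graphSet]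
  rfl

theorem measurable_iterate_transfer {φ : GStar → ℝ≥0∞} (hφ : Measurable φ) (n : ℕ) :
    Measurable (f.transfer^[n] φ) := by
  induction n with
  | zero => exact hφ
  | succ n ih => rw [Function.iterate_succ_apply']; exact f.measurable_transfer ih

open Classical in
theorem toENNReal_encard_eq_tsum {α : Type*} (s : Set α) :
    (s.encard : ℝ≥0∞) = ∑' v, if v ∈ s then 1 else 0 := by
  rw [← ENNReal.tsum_set_one, tsum_subtype s (fun _ => (1 : ℝ≥0∞))]
  exact tsum_congr fun v => Set.indicator_apply _ _ _

theorem iterate_transfer_one (n : ℕ) (x : GStar) :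
    f.transfer^[n] (fun _ => 1) x = (f.descendantCount n x : ℝ≥0∞) := by
  classical
  induction n generalizing x with
  | zero =>
    induction x using gStar_ind with | _ G o => ?_
    rw [descendantCount_mk]
    simp
  | succ n ih =>
    rw [Function.iterate_succ_apply']
    induction x using gStar_ind with | _ G o => ?_
    rw [f.transfer_mk (f.measurable_iterate_transfer measurable_const n), descendantCount_mk,
      toENNReal_encard_eq_tsum]
    simp only [ih, descendantCount_mk, toENNReal_encard_eq_tsum, ← ENNReal.tsum_mul_left,
      Set.mem_ofPred_eq]
    rw [ENNReal.tsum_comm]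
    refine tsum_congr fun v => ?_
    -- After exchanging the sums, each `v` is counted only through `u = f^n(v)`.
    rw [tsum_eq_single ((f.toFun G)^[n] v) fun u hu => by rw [if_neg (Ne.symm hu), mul_zero]]
    simp only [Function.iterate_succ_apply', if_true, mul_one]

theorem measurable_descendantCount (n : ℕ) :
    Measurable fun x => (f.descendantCount n x : ℝ≥0∞) := by
  simp only [← f.iterate_transfer_one]
  exact f.measurable_iterate_transfer measurable_const n

end VertexShift

/-! ### Mass transport and the duality of shift and transfer. -/

theorem massOut_indicator {E : Set GStarStar} (hE : MeasurableSet E) (x : GStar) :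
    massOut (E.indicator 1) x = pairMeasure x E := by
  classical
  induction x using gStar_ind with | _ G o => ?_
  rw [pairMeasure_apply _ _ hE, VertexShift.toENNReal_encard_eq_tsum]
  refine tsum_congr fun u => ?_
  show ((E.indicator 1 (NetworkSpace.mk G ![o, u]) : ℝ≥0) : ℝ≥0∞) = _
  rw [Set.indicator_apply]
  simp only [Set.mem_ofPred_eq]
  split_ifs <;> simp

theorem massIn_indicator {E : Set GStarStar} (hE : MeasurableSet E) (x : GStar) :
    massIn (E.indicator 1) x = pairMeasure x (swapRoot ⁻¹' E) := by
  classical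
  induction x using gStar_ind with | _ G o => ?_
  rw [pairMeasure_apply _ _ (measurable_swapRoot hE), VertexShift.toENNReal_encard_eq_tsum]
  refine tsum_congr fun u => ?_
  show ((E.indicator 1 (NetworkSpace.mk G ![u, o]) : ℝ≥0) : ℝ≥0∞) = _
  rw [Set.indicator_apply]
  simp only [Set.mem_ofPred_eq, Set.mem_preimage, swapRoot_mk]
  split_ifs <;> simp

/-- Unimodularity as the invariance of a measure on doubly rooted networks. -/
theorem IsUnimodular.bind_pairMeasure {P : Measure GStar} (hP : IsUnimodular P) :
    (P.bind pairMeasure).map swapRoot = P.bind pairMeasure := by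
  ext E hE
  rw [Measure.map_apply measurable_swapRoot hE,
    Measure.bind_apply (measurable_swapRoot hE) measurable_pairMeasure.aemeasurable,
    Measure.bind_apply hE measurable_pairMeasure.aemeasurable]
  -- Indicators suffice to identify the measures; this extends the principle from finite-valued `h`
  -- to `ℝ≥0∞`-valued ones.
  simp only [← massOut_indicator hE, ← massIn_indicator hE]
  exact (hP _ (measurable_one.indicator hE)).symm

namespace VertexShift

variable (f : VertexShift)

/-- The left integrand is the mass that the root sends to its image under `f`; the right one is the
mass that the root receives from its preimages. -/
theorem lintegral_mul_shift {P : Measure GStar} (hP : IsUnimodular P) {φ g : GStar → ℝ≥0∞}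
    (hφ : Measurable φ) (hg : Measurable g) :
    ∫⁻ x, φ x * g (f.shift x) ∂P = ∫⁻ x, g x * f.transfer φ x ∂P := by
  classical
  have hF : Measurable (f.graphSet.indicator (1 : GStarStar → ℝ≥0∞)) :=
    measurable_one.indicator f.measurableSet_graphSet
  let H : GStarStar → ℝ≥0∞ := fun y =>
    f.graphSet.indicator (1 : GStarStar → ℝ≥0∞) y * φ (fstRoot y) * g (sndRoot y)
  have hH : Measurable H :=
    (hF.mul (hφ.comp measurable_fstRoot)).mul (hg.comp measurable_sndRoot)
  have h1 : ∀ x, φ x * g (f.shift x) =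
      ∫⁻ y, H y ∂pairMeasure x := fun x => by
    induction x using gStar_ind with | _ G o => ?_
    rw [lintegral_pairMeasure _ _ hH, shift_mk, tsum_eq_single (f.toFun G o)]
    · dsimp only [H]
      rw [Set.indicator_of_mem (f.mk_mem_graphSet.2 rfl), fstRoot_mk, sndRoot_mk, Pi.one_apply, one_mul]
    · intro v hv
      dsimp only [H]
      rw [Set.indicator_of_notMem fun h => hv (f.mk_mem_graphSet.1 h).symm, zero_mul, zero_mul]
  have h2 : ∀ x, g x * f.transfer φ x = ∫⁻ y, (H ∘ swapRoot) y ∂pairMeasure x := fun x => by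
    induction x using gStar_ind with | _ G o => ?_
    rw [lintegral_pairMeasure _ _ (hH.comp measurable_swapRoot), f.transfer_mk hφ,
      ← ENNReal.tsum_mul_left]
    refine tsum_congr fun u => ?_
    dsimp only [H, Function.comp_apply]
    rw [swapRoot_mk, fstRoot_mk, sndRoot_mk, Set.indicator_apply, f.mk_mem_graphSet, Pi.one_apply, mul_comm]
  simp only [h1, h2]
  rw [← Measure.lintegral_bind measurable_pairMeasure.aemeasurable hH.aemeasurable,
    ← Measure.lintegral_bind measurable_pairMeasure.aemeasurable
      (hH.comp measurable_swapRoot).aemeasurable]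
  conv_lhs => rw [← hP.bind_pairMeasure]
  exact lintegral_map hH measurable_swapRoot

theorem lintegral_mul_iterate_shift {P : Measure GStar} (hP : IsUnimodular P)
    {φ g : GStar → ℝ≥0∞} (hφ : Measurable φ) (hg : Measurable g) (n : ℕ) :
    ∫⁻ x, φ x * g (f.shift^[n] x) ∂P = ∫⁻ x, g x * f.transfer^[n] φ x ∂P := by
  induction n generalizing φ with
  | zero => exact lintegral_congr fun x => mul_comm _ _
  | succ n ih =>
    simp only [Function.iterate_succ_apply]
    rw [← ih (f.measurable_transfer hφ)]
    refine (f.lintegral_mul_shift hP hφ (hg.comp (f.measurable_shift.iterate n))).trans ?_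
    exact lintegral_congr fun x => mul_comm _ _

/-- For a unimodular law, `d_n` is the density of the law of `[G, f_G^n(o)]`. -/
theorem lintegral_iterate_shift {P : Measure GStar} (hP : IsUnimodular P) {g : GStar → ℝ≥0∞}
    (hg : Measurable g) (n : ℕ) :
    ∫⁻ x, g (f.shift^[n] x) ∂P = ∫⁻ x, g x * (f.descendantCount n x : ℝ≥0∞) ∂P := by
  have := f.lintegral_mul_iterate_shift hP (measurable_const (a := (1 : ℝ≥0∞))) hg n
  simpa only [one_mul, iterate_transfer_one] using this

end VertexShift

end VertexShiftNetworks

namespace VertexShiftNetworks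

open NetworkSpace

/-! ### Limits of orbits, of descendant counts and of laws. -/

namespace VertexShift

variable (f : VertexShift)

theorem IsPeriodicAt.isTrap_eventualTrap {f : VertexShift} {x : GStar}
    (hx : f.IsPeriodicAt 1 x) : f.IsTrap (f.eventualTrap x) := by
  classical
  induction x using gStar_ind with | _ G o => ?_
  obtain ⟨k, -, hk⟩ := hx
  have h : ∃ n, f.toFun G ((f.toFun G)^[n] o) = (f.toFun G)^[n] o :=
    ⟨k, by rw [← Function.iterate_succ_apply' (f.toFun G)]; exact hk k le_rfl⟩
  show f.toFun G (f.trapVertex G o) = f.trapVertex G o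
  rw [trapVertex, dif_pos h]
  exact Nat.find_spec h

theorem IsPeriodicAt.eventually_eq {f : VertexShift} {x : GStar} (hx : f.IsPeriodicAt 1 x) :
    ∀ᶠ n in atTop, f.shift^[n] x = f.eventualTrap x := by
  classical
  induction x using gStar_ind with | _ G o => ?_
  obtain ⟨k, -, hk⟩ := hx
  have h : ∃ n, f.toFun G ((f.toFun G)^[n] o) = (f.toFun G)^[n] o :=
    ⟨k, by rw [← Function.iterate_succ_apply' (f.toFun G)]; exact hk k le_rfl⟩
  filter_upwards [eventually_ge_atTop (Nat.find h)] with n hn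
  rw [iterate_shift_mk]
  show NetworkSpace.mk G (fun _ => _) = NetworkSpace.mk G fun _ => f.trapVertex G o
  rw [trapVertex, dif_pos h]
  congr 1
  funext _
  obtain ⟨m, rfl⟩ := Nat.exists_eq_add_of_le' hn
  rw [Function.iterate_add_apply]
  exact Function.iterate_fixed (Nat.find_spec h) m

theorem IsTrap.monotone_descendantCount {f : VertexShift} {x : GStar} (hx : f.IsTrap x) :
    Monotone fun n => (f.descendantCount n x : ℝ≥0∞) := by
  refine monotone_nat_of_le_succ fun n => ?_
  induction x using gStar_ind with | _ G o => ?_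
  refine ENat.toENNReal_le.2 (Set.encard_le_encard fun v hv => ?_)
  show (f.toFun G)^[n + 1] v = o
  rw [Function.iterate_succ_apply', show (f.toFun G)^[n] v = o from hv]
  exact hx

/-- At a trap the sets of order-`n` descendants increase to the set of all descendants; counting
measure is continuous from below. -/
theorem IsTrap.tendsto_descendantCount {f : VertexShift} {x : GStar} (hx : f.IsTrap x) :
    Tendsto (fun n => (f.descendantCount n x : ℝ≥0∞)) atTop
      (𝓝 (f.totalDescendants x : ℝ≥0∞)) := by
  induction x using gStar_ind with | _ G o => ?_
  let _ : MeasurableSpace G.V := ⊤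
  have hmono : Monotone fun n => {v | (f.toFun G)^[n] v = o} :=
    monotone_nat_of_le_succ fun n v hv => by
      show (f.toFun G)^[n + 1] v = o
      rw [Function.iterate_succ_apply', show (f.toFun G)^[n] v = o from hv]
      exact hx
  have h := tendsto_measure_iUnion_atTop (μ := Measure.count) hmono
  have e : ⋃ n, {v | (f.toFun G)^[n] v = o} = {v | ∃ n, (f.toFun G)^[n] v = o} := by
    ext v; simp
  rw [e, Measure.count_apply MeasurableSpace.measurableSet_top] at h
  exact h.congr fun n => Measure.count_apply MeasurableSpace.measurableSet_top

theorem IsTrap.limitDescendants_eq {f : VertexShift} {x : GStar} (hx : f.IsTrap x) :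
    f.limitDescendants x = (f.totalDescendants x : ℝ≥0∞) :=
  hx.tendsto_descendantCount.limUnder_eq

theorem IsTrap.tendsto_limitDescendants {f : VertexShift} {x : GStar} (hx : f.IsTrap x) :
    Tendsto (fun n => (f.descendantCount n x : ℝ≥0∞)) atTop (𝓝 (f.limitDescendants x)) :=
  hx.limitDescendants_eq ▸ hx.tendsto_descendantCount

theorem tendsto_indicator_descendantCount (x : GStar) :
    Tendsto (fun n => {x | f.IsTrap x}.indicator
      (fun x => (f.descendantCount n x : ℝ≥0∞)) x) atTop
      (𝓝 ({x | f.IsTrap x}.indicator f.limitDescendants x)) := by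
  by_cases hx : f.IsTrap x
  · simpa only [Set.indicator_of_mem (show x ∈ {x | f.IsTrap x} from hx)] using
      hx.tendsto_limitDescendants
  · simp only [Set.indicator_of_notMem (show x ∉ {x | f.IsTrap x} from hx)]
    exact tendsto_const_nhds

/-- The indicator removes the points where `limitDescendants` may be a junk value, leaving a
pointwise limit of measurable functions. -/
theorem measurable_indicator_limitDescendants :
    Measurable ({x | f.IsTrap x}.indicator f.limitDescendants) :=
  measurable_of_tendsto_metrizable
    (fun n => (f.measurable_descendantCount n).indicator f.measurableSet_isTrap)
    (tendsto_pi_nhds.2 f.tendsto_indicator_descendantCount)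

section Law

variable {Ω : Type*} [MeasurableSpace Ω] {ℙ : Measure Ω} {X : Ω → GStar}

theorem tendsto_iterate_shift (hf : ∀ᵐ ω ∂ℙ, f.IsPeriodicAt 1 (X ω)) :
    ∀ᵐ ω ∂ℙ, Tendsto (fun n => f.shift^[n] (X ω)) atTop (𝓝 (f.eventualTrap (X ω))) := by
  filter_upwards [hf] with ω hω
  exact tendsto_const_nhds.congr' (hω.eventually_eq.mono fun n hn => hn.symm)

theorem aemeasurable_eventualTrap (hX : Measurable X)
    (hf : ∀ᵐ ω ∂ℙ, f.IsPeriodicAt 1 (X ω)) :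
    AEMeasurable (fun ω => f.eventualTrap (X ω)) ℙ :=
  aemeasurable_of_tendsto_metrizable_ae atTop
    (fun n => ((f.measurable_shift.iterate n).comp hX).aemeasurable) (f.tendsto_iterate_shift hf)

/-- For a unimodular law, the law of the eventual trap has density `d_∞` on the traps. -/
theorem map_eventualTrap_eq_withDensity [IsFiniteMeasure ℙ] (hX : Measurable X)
    (hf : ∀ᵐ ω ∂ℙ, f.IsPeriodicAt 1 (X ω)) (hP : IsUnimodular (ℙ.map X)) :
    ℙ.map (fun ω => f.eventualTrap (X ω)) =
      (ℙ.map X).withDensity ({x | f.IsTrap x}.indicator f.limitDescendants) := by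
  set T : Set GStar := {x | f.IsTrap x}
  have hT : MeasurableSet T := f.measurableSet_isTrap
  ext A hA
  -- Intersecting with `T` costs nothing in the limit, since the eventual trap lies in `T`, and it
  -- keeps `d_n` only where it is monotone in `n`.
  have hg : Measurable ((A ∩ T).indicator (1 : GStar → ℝ≥0∞)) :=
    measurable_one.indicator (hA.inter hT)
  have h1 : Tendsto (fun n => ∫⁻ ω, (A ∩ T).indicator 1 (f.shift^[n] (X ω)) ∂ℙ) atTop
      (𝓝 (∫⁻ ω, A.indicator 1 (f.eventualTrap (X ω)) ∂ℙ)) := by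
    refine tendsto_lintegral_of_dominated_convergence (fun _ => 1)
      (fun n => hg.comp ((f.measurable_shift.iterate n).comp hX))
      (fun n => ae_of_all _ fun ω => Set.indicator_le_self _ _ _) (by simp) ?_
    filter_upwards [hf] with ω hω
    -- The orbit is eventually constant, so no continuity of the indicator is needed.
    refine tendsto_const_nhds.congr' (hω.eventually_eq.mono fun n hn => ?_)
    have hωT : f.eventualTrap (X ω) ∈ T := hω.isTrap_eventualTrap
    by_cases hωA : f.eventualTrap (X ω) ∈ A <;> simp [hn, hωA, hωT]
  have h2 : ∫⁻ ω, A.indicator 1 (f.eventualTrap (X ω)) ∂ℙ =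
      ℙ.map (fun ω => f.eventualTrap (X ω)) A := by
    rw [← lintegral_map' (measurable_one.indicator hA).aemeasurable
      (f.aemeasurable_eventualTrap hX hf), lintegral_indicator_one hA]
  have h3 : ∀ n, ∫⁻ ω, (A ∩ T).indicator 1 (f.shift^[n] (X ω)) ∂ℙ =
      ∫⁻ x in A, T.indicator (fun x => (f.descendantCount n x : ℝ≥0∞)) x ∂(ℙ.map X) := by
    intro n
    refine (lintegral_map (hg.comp (f.measurable_shift.iterate n)) hX).symm.trans ?_
    refine (f.lintegral_iterate_shift hP hg n).trans ?_
    rw [← lintegral_indicator hA]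
    refine lintegral_congr fun x => ?_
    by_cases hxA : x ∈ A <;> by_cases hxT : x ∈ T <;> simp [hxA, hxT]
  have h4 : Tendsto (fun n => ∫⁻ x in A,
      T.indicator (fun x => (f.descendantCount n x : ℝ≥0∞)) x ∂(ℙ.map X)) atTop
      (𝓝 (∫⁻ x in A, T.indicator f.limitDescendants x ∂(ℙ.map X))) := by
    refine lintegral_tendsto_of_tendsto_of_monotone
      (fun n => ((f.measurable_descendantCount n).indicator hT).aemeasurable)
      (ae_of_all _ fun x => ?_) (ae_of_all _ f.tendsto_indicator_descendantCount)
    by_cases hx : x ∈ T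
    · simpa only [Set.indicator_of_mem hx] using IsTrap.monotone_descendantCount hx
    · simp only [Set.indicator_of_notMem hx]
      exact monotone_const
  rw [withDensity_apply _ hA, ← h2]
  simp only [h3] at h1
  exact tendsto_nhds_unique h1 h4

theorem tendsto_map_iterate_shift [IsFiniteMeasure ℙ] (hX : Measurable X)
    (hf : ∀ᵐ ω ∂ℙ, f.IsPeriodicAt 1 (X ω)) {Pn : ℕ → ProbabilityMeasure GStar}
    (hPn : ∀ n, (Pn n : Measure GStar) = (ℙ.map X).map (f.shift^[n]))
    {Q : ProbabilityMeasure GStar}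
    (hQ : (Q : Measure GStar) = ℙ.map (fun ω => f.eventualTrap (X ω))) :
    Tendsto Pn atTop (𝓝 Q) := by
  refine ProbabilityMeasure.tendsto_iff_forall_lintegral_tendsto.2 fun g => ?_
  have hg : Measurable fun x => (g x : ℝ≥0∞) := g.continuous.measurable.coe_nnreal_ennreal
  have hs : ∀ n, Measurable fun ω => f.shift^[n] (X ω) := fun n =>
    (f.measurable_shift.iterate n).comp hX
  simp only [hPn, hQ]
  rw [lintegral_map' hg.aemeasurable (f.aemeasurable_eventualTrap hX hf)]
  have e : ∀ n, ∫⁻ x, (g x : ℝ≥0∞) ∂((ℙ.map X).map (f.shift^[n])) =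
      ∫⁻ ω, (g (f.shift^[n] (X ω)) : ℝ≥0∞) ∂ℙ := fun n => by
    rw [Measure.map_map (f.measurable_shift.iterate n) hX]
    exact lintegral_map hg (hs n)
  simp only [e]
  refine tendsto_lintegral_of_dominated_convergence (fun _ => (nndist g 0 : ℝ≥0∞))
    (fun n => hg.comp (hs n))
    (fun n => ae_of_all _ fun ω => ENNReal.coe_le_coe.2 (BoundedContinuousFunction.NNReal.upper_bound g _)) ?_ ?_
  · rw [lintegral_const]
    exact ENNReal.mul_ne_top ENNReal.coe_ne_top (measure_ne_top _ _)
  · filter_upwards [f.tendsto_iterate_shift hf] with ω hω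
    exact ((ENNReal.continuous_coe.comp g.continuous).tendsto _).comp hω

end Law

end VertexShift

end VertexShiftNetworks

/-! ### Assembly of the main theorem. -/

theorem mainTheorem12 {Ω : Type*} [MeasurableSpace Ω] (ℙ : Measure Ω) [IsProbabilityMeasure ℙ]
    (X : Ω → GStar) (hX : Measurable X) (f : VertexShift)
    (hf : ∀ᵐ ω ∂ℙ, f.IsPeriodicAt 1 (X ω)) :
    AEMeasurable (fun ω => f.eventualTrap (X ω)) ℙ ∧
    (∀ᵐ ω ∂ℙ, f.IsTrap (f.eventualTrap (X ω)) ∧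
      Tendsto (fun n => f.shift^[n] (X ω)) atTop (𝓝 (f.eventualTrap (X ω)))) ∧
    ∃ Q : ProbabilityMeasure GStar,
      (∀ Q' : ProbabilityMeasure GStar, f.IsFProbability (ℙ.map X) Q' ↔ Q' = Q) ∧
      (Q : Measure GStar) = ℙ.map (fun ω => f.eventualTrap (X ω)) ∧
      (IsUnimodular (ℙ.map X) →
        (Q : Measure GStar) ≪ ℙ.map X ∧
        (∀ x, f.IsTrap x →
          Tendsto (fun n => (f.descendantCount n x : ℝ≥0∞)) atTop (𝓝 (f.limitDescendants x)) ∧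
          f.limitDescendants x = (f.totalDescendants x : ℝ≥0∞)) ∧
        (∀ᵐ x ∂(Q : Measure GStar),
          Tendsto (fun n => (f.descendantCount n x : ℝ≥0∞)) atTop (𝓝 (f.limitDescendants x)) ∧
          f.limitDescendants x < ∞) ∧
        (Q : Measure GStar).rnDeriv (ℙ.map X) =ᵐ[ℙ.map X]
          {x | f.IsTrap x}.indicator f.limitDescendants) := by
  have hm := f.aemeasurable_eventualTrap hX hf
  have hprob : IsProbabilityMeasure (ℙ.map X) := Measure.isProbabilityMeasure_map hX.aemeasurable
  have htrap : ∀ᵐ ω ∂ℙ, f.IsTrap (f.eventualTrap (X ω)) :=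
    hf.mono fun ω hω => hω.isTrap_eventualTrap
  refine ⟨hm, htrap.and (f.tendsto_iterate_shift hf),
    ⟨ℙ.map (fun ω => f.eventualTrap (X ω)), Measure.isProbabilityMeasure_map hm⟩, fun Q' => ?_, rfl,
    fun hP => ?_⟩
  · constructor
    · rintro ⟨Pn, hPn, hlim⟩
      exact tendsto_nhds_unique hlim
        (f.tendsto_map_iterate_shift hX hf (fun n => (hPn n).2) rfl)
    · rintro rfl
      have hs := fun n => (f.measurable_shift.iterate n).aemeasurable (μ := ℙ.map X)
      exact ⟨fun n => ⟨_, Measure.isProbabilityMeasure_map (hs n)⟩, fun n => ⟨hs n, rfl⟩,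
        f.tendsto_map_iterate_shift hX hf (fun n => rfl) rfl⟩
  · have hd := f.map_eventualTrap_eq_withDensity hX hf hP
    have hρ := f.measurable_indicator_limitDescendants
    have hac : ℙ.map (fun ω => f.eventualTrap (X ω)) ≪ ℙ.map X :=
      hd ▸ withDensity_absolutelyContinuous _ _
    refine ⟨hac, fun x hx => ⟨hx.tendsto_limitDescendants, hx.limitDescendants_eq⟩, ?_, ?_⟩
    · have hfin : ∀ᵐ x ∂(ℙ.map X), {x | f.IsTrap x}.indicator f.limitDescendants x < ∞ := by
        refine ae_lt_top hρ ?_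
        -- The integral of the density is the total mass of a probability measure.
        rw [← setLIntegral_univ, ← withDensity_apply _ .univ, ← hd]
        have := Measure.isProbabilityMeasure_map hm
        exact measure_ne_top _ _
      have hT : ∀ᵐ x ∂(ℙ.map fun ω => f.eventualTrap (X ω)), f.IsTrap x :=
        (ae_map_iff hm f.measurableSet_isTrap).2 htrap
      filter_upwards [hac.ae_le hfin, hT] with x hx hxT
      rw [Set.indicator_of_mem (show x ∈ {x | f.IsTrap x} from hxT)] at hx
      exact ⟨hxT.tendsto_limitDescendants, hx⟩
    · show (ℙ.map fun ω => f.eventualTrap (X ω)).rnDeriv (ℙ.map X) =ᵐ[_] _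
      rw [hd]
      exact Measure.rnDeriv_withDensity _ hρ
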